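/- Let $k$ be an arbitrary field, $d>0$ an integer and $n=2(1+d)$. Let $p_1,\dots,p_n$ be pairwise distinct $k$-rational points of $\mathbb{P}^1_k$ with $p_1=\infty=[1;0]$, $p_2=[0;1]$, $p_3=[1;1]$ and $p_i=[\alpha_i;1]$ for $i\ge 2$ (so $\alpha_2=0$, $\alpha_3=1$). Let $t$ be the affine coordinate with $t(p_i)=\alpha_i$ for $i\geq 2$, and let $u=t^{-1}$, a local parameter at $p_1$. Let $L=\mathcal{O}_{\mathbb{P}^1}(d\infty)$, with the trivializations $\gamma_i^0:L|_{p_i}\simeq k$ given by $\gamma_i^0(f)=f(\alpha_i)$ for $i\ge 2$, and $\gamma_1^0(f)=g(0)$ with $g(u)=u^df(u^{-1})$. Let $l_1,\dots,l_n\in k^{*}$ with $l_n=1$, and consider the level structure $$\mathfrak{g}'=(\mathbb{P}^1_k,\,p_1,\dots,p_n,\,\mathcal{O}_{\mathbb{P}^1}(d\infty),\,l_1\gamma_1^0,\dots,l_n\gamma_n^0).$$ Its Goppa code $C_{\mathfrak{g}'}\subset k^n$ is the image of the evaluation map $H^0(\mathbb{P}^1_k,L)\to\bigoplus_i L|_{p_i}\simeq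 k^n$, where the isomorphism is $\bigoplus_i l_i\gamma_i^0$. The level structure $\mathfrak{g}'$ is called self-dual if $C_{\mathfrak{g}'}=C_{\mathfrak{g}'}^{\perp}$ for the standard pairing $\langle w',w\rangle=\sum_i w'_iw_i$ on $k^n$. Then $\mathfrak{g}'$ is self-dual if and only if there exists a meromorphic differential form $\eta$ on $\mathbb{P}^1_k$ which is regular outside $\{p_1,\dots,p_n\}$, has at most simple poles at $p_2,\dots,p_n$, has a zero of order at least $2d-1$ at $p_1$, and satisfies $$\operatorname{Res}_{p_i}(\eta)=l_i^2\quad (i=2,\dots,n),\qquad \operatorname{Res}_{p_1}\!\left(\frac{\eta}{u^{2d}}\right)=l_1^2 .$$ -/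

import Mathlib

open Polynomial KaehlerDifferential WithZero LaurentSeries IsDedekindDomain
open scoped nonZeroDivisors TensorProduct

noncomputable section

namespace GoppaP1

variable (k : Type*) [Field k]

/-! ### Points of the projective line

The projective line over `k`, with function field `k(t) = RatFunc k` and coordinate
`t = RatFunc.X`; the point `[1 ; 0]` is `∞` and `[a ; 1]` is the rational point `t = a`. -/

/-- Closed points: the maximal ideals of `k[t]`, together with `∞`. -/
abbrev ClosedPoint : Type _ := OnePoint (HeightOneSpectrum k[X])

/-- Rational points: the elements of `k`, together with `∞`. -/
abbrev RatPoint : Type _ := OnePoint k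

variable {k}

/-- The maximal ideal `(t - a)` of `k[t]`. -/
def maxIdealAt (a : k) : HeightOneSpectrum k[X] where
  asIdeal := Ideal.span {X - C a}
  isPrime := (Ideal.span_singleton_prime (X_sub_C_ne_zero a)).2 (prime_X_sub_C a)
  ne_bot := by simpa [Ideal.span_singleton_eq_bot] using X_sub_C_ne_zero a

/-- A rational point seen as a closed point. -/
def RatPoint.toClosed (x : RatPoint k) : ClosedPoint k := OnePoint.map maxIdealAt x

/-- The (multiplicative) valuation of `k(t)` at a closed point `x`: it maps `f` to
`exp (-ord_x f)`, and `0` to `0`. -/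
def val (x : ClosedPoint k) : Valuation (RatFunc k) ℤᵐ⁰ :=
  open Classical in
  x.elim (RatFunc.inftyValuation k) fun v => v.valuation (RatFunc k)

/-- The degree over `k` of the residue field of a closed point. -/
def ClosedPoint.degree (x : ClosedPoint k) : ℕ :=
  x.elim 1 fun v => Module.finrank k (k[X] ⧸ v.asIdeal)

/-! ### Expansions at rational points -/

theorem algebraMap_X_inv_ne_zero {p : k[X]} (hp : p ≠ 0) :
    aeval (RatFunc.X : RatFunc k)⁻¹ p ≠ 0 := by
  have h : Transcendental k (RatFunc.X : RatFunc k)⁻¹ := by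
    intro h
    exact RatFunc.transcendental_X (IsAlgebraic.inv_iff.1 h)
  exact fun h0 => h ⟨p, hp, h0⟩

/-- The substitution `f(t) ↦ f(1/t)`. -/
def substInv : RatFunc k →ₐ[k] RatFunc k :=
  RatFunc.liftAlgHom (aeval (RatFunc.X : RatFunc k)⁻¹) fun p hp => by
    simpa using algebraMap_X_inv_ne_zero (nonZeroDivisors.ne_zero hp)

theorem substInv_X : substInv (RatFunc.X : RatFunc k) = RatFunc.X⁻¹ := by
  rw [← RatFunc.algebraMap_X, substInv]
  simp [RatFunc.liftAlgHom_apply]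

/-- A rational function written in the local parameter `u` of a rational point: `f(a + u)` at
`t = a` (where `u = t - a`), and `f(1/u)` at `∞` (where `u = 1/t`). -/
def inLocalParam (x : RatPoint k) : RatFunc k →ₐ[k] RatFunc k :=
  x.elim substInv fun a => RatFunc.laurent a

/-- The Laurent expansion of a rational function at a rational point, in the parameter `u = t - a`
at `t = a`, and `u = 1/t` at `∞`. -/
def expansion (x : RatPoint k) (f : RatFunc k) : k⸨X⸩ :=
  (inLocalParam x f : k⸨X⸩)

/-! ### Divisors, invertible sheaves and their fibres -/

variable (k) in
/-- Divisors on the projective line. -/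
abbrev Divisor : Type _ := ClosedPoint k →₀ ℤ

/-- The degree of a divisor. -/
def Divisor.degree (G : Divisor k) : ℤ := G.sum fun x m => m * ClosedPoint.degree x

/-- The stalk at `x` of the invertible sheaf `O(G)`: the rational functions `f` with
`ord_x f + G(x) ≥ 0`. -/
def stalk (G : Divisor k) (x : ClosedPoint k) : Submodule k (RatFunc k) where
  carrier := {f | val x f ≤ exp (G x)}
  zero_mem' := by simp
  add_mem' {f g} hf hg := ((val x).map_add f g).trans (max_le hf hg)
  smul_mem' c f hf := by
    have hc : val x (algebraMap k (RatFunc k) c) ≤ 1 := by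
      induction x using OnePoint.rec with
      | infty =>
        classical
        by_cases h : c = 0
        · simp [h]
        · have := RatFunc.inftyValuation.C k h
          rw [RatFunc.algebraMap_eq_C]
          exact le_of_eq (by simpa [val] using this)
      | coe v =>
        have := v.valuation_le_one (K := RatFunc k) (C c)
        exact this
    show val x (c • f) ≤ _
    rw [Algebra.smul_def, map_mul]
    exact (mul_le_mul' hc hf).trans (by rw [one_mul])

/-- The global sections `H⁰(P¹, O(G))`. -/
def globalSections (G : Divisor k) : Submodule k (RatFunc k) := ⨅ x, stalk G x

/-- The submodule `m_x O(G)_x = O(G - x)_x` of the stalk `O(G)_x`. -/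
def maxStalk (G : Divisor k) (x : ClosedPoint k) : Submodule k (stalk G x) :=
  (stalk (G - Finsupp.single x 1) x).comap (stalk G x).subtype

/-- The fibre `O(G)|_x = O(G)_x / m_x O(G)_x`. -/
abbrev Fiber (G : Divisor k) (x : ClosedPoint k) : Type _ := stalk G x ⧸ maxStalk G x

/-- The restriction of global sections to the fibre at `x`. -/
def restrict (G : Divisor k) (x : ClosedPoint k) : globalSections G →ₗ[k] Fiber G x :=
  (maxStalk G x).mkQ ∘ₗ Submodule.inclusion (iInf_le _ x)

theorem stalk_trivialOn (x : ClosedPoint k) {c : k} (hc : c ≠ 0) :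
    val x (algebraMap k (RatFunc k) c) = 1 := by
  induction x using OnePoint.rec with
  | infty =>
    classical
    have := RatFunc.inftyValuation.C k hc
    rw [RatFunc.algebraMap_eq_C]
    simpa [val] using this
  | coe v =>
    have h1 := v.valuation_le_one (K := RatFunc k) (C c)
    have h2 := v.valuation_le_one (K := RatFunc k) (C c⁻¹)
    have h3 : v.valuation (RatFunc k) (algebraMap k[X] _ (C c)) *
        v.valuation (RatFunc k) (algebraMap k[X] _ (C c⁻¹)) = 1 := by
      rw [← map_mul, ← map_mul, ← C_mul, mul_inv_cancel₀ hc]; simp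
    have h4 : v.valuation (RatFunc k) (algebraMap k[X] _ (C c)) = 1 :=
      le_antisymm h1 (h3 ▸ (mul_le_of_le_one_right' h2))
    exact h4

theorem val_eq_of_X {v w : Valuation (RatFunc k) ℤᵐ⁰}
    (hv : ∀ c : k, c ≠ 0 → v (algebraMap k _ c) = 1)
    (hw : ∀ c : k, c ≠ 0 → w (algebraMap k _ c) = 1)
    (hvX : v RatFunc.X = exp (-1)) (hwX : w RatFunc.X = exp (-1)) : v = w := by
  have key : ∀ u : Valuation (RatFunc k) ℤᵐ⁰, (∀ c : k, c ≠ 0 → u (algebraMap k _ c) = 1) →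
      u RatFunc.X = exp (-1) → (∀ q : k[X], u (algebraMap k[X] _ q) ≤ 1) ∧
      ∀ q : k[X], q.coeff 0 ≠ 0 → u (algebraMap k[X] _ q) = 1 := by
    intro u hu huX
    have hX1 : u RatFunc.X < 1 := by rw [huX, ← exp_zero]; exact exp_lt_exp.2 (by norm_num)
    have h1 : ∀ q : k[X], u (algebraMap k[X] _ q) ≤ 1 := by
      intro q
      induction q using Polynomial.induction_on' with
      | add p q hp hq => rw [map_add]; exact (u.map_add _ _).trans (max_le hp hq)
      | monomial n a =>
        rw [← C_mul_X_pow_eq_monomial, map_mul, map_pow, map_mul, map_pow, RatFunc.algebraMap_X,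
          RatFunc.algebraMap_C, ← RatFunc.algebraMap_eq_C]
        refine mul_le_one' ?_ (pow_le_one' hX1.le _)
        by_cases ha : a = 0
        · simp [ha]
        · exact (hu a ha).le
    refine ⟨h1, fun q hq => ?_⟩
    have hd : algebraMap k[X] (RatFunc k) q =
        algebraMap k[X] _ q.divX * RatFunc.X + algebraMap k _ (q.coeff 0) := by
      conv_lhs => rw [← Polynomial.divX_mul_X_add q]
      rw [map_add, map_mul, RatFunc.algebraMap_X, RatFunc.algebraMap_C, RatFunc.algebraMap_eq_C]
    rw [hd, Valuation.map_add_eq_of_lt_right, hu _ hq]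
    rw [hu _ hq, map_mul]
    exact (mul_le_of_le_one_left' (h1 _)).trans_lt hX1
  have hpoly : ∀ p : k[X], v (algebraMap k[X] _ p) = w (algebraMap k[X] _ p) := by
    intro p
    by_cases hp : p = 0
    · simp [hp]
    obtain ⟨q, hq, hq'⟩ := Polynomial.exists_eq_pow_rootMultiplicity_mul_and_not_dvd p hp 0
    rw [C_0, sub_zero] at hq hq'
    rw [Polynomial.X_dvd_iff] at hq'
    rw [hq]
    simp only [map_mul, map_pow, RatFunc.algebraMap_X]
    rw [(key v hv hvX).2 q hq', (key w hw hwX).2 q hq', hvX, hwX]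
  ext f
  induction f using RatFunc.induction_on with
  | f p q hq => rw [map_div₀, map_div₀, hpoly, hpoly]

theorem inLocalParam_rightInverse (x : RatPoint k) :
    ∃ τ : RatFunc k →ₐ[k] RatFunc k, (∀ f, τ (inLocalParam x f) = f) ∧
      inLocalParam x (τ RatFunc.X) = RatFunc.X ∧
      val x.toClosed (τ RatFunc.X) = exp (-1) := by
  have hext : ∀ σ : RatFunc k →ₐ[k] RatFunc k, σ RatFunc.X = RatFunc.X → ∀ f, σ f = f := by
    intro σ hσ f
    have hp : ∀ p : k[X], σ (algebraMap k[X] _ p) = algebraMap k[X] _ p := by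
      intro p
      induction p using Polynomial.induction_on' with
      | add p q hp hq => simp [hp, hq]
      | monomial n a =>
        rw [← C_mul_X_pow_eq_monomial, map_mul, map_pow, map_mul, map_pow, RatFunc.algebraMap_X,
          RatFunc.algebraMap_C, ← RatFunc.algebraMap_eq_C, hσ, AlgHom.commutes]
    induction f using RatFunc.induction_on with
    | f p q hq => rw [map_div₀, hp, hp]
  induction x using OnePoint.rec with
  | infty =>
    have h : substInv (substInv (RatFunc.X : RatFunc k)) = RatFunc.X := by
      rw [substInv_X, map_inv₀, substInv_X, inv_inv]
    refine ⟨substInv, hext (substInv.comp substInv) h, h, ?_⟩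
    classical
    have := RatFunc.inftyValuation.X_inv k
    rw [one_div] at this
    rw [substInv_X]
    exact this
  | coe a =>
    refine ⟨RatFunc.laurent (-a), ?_, ?_, ?_⟩
    · intro f
      show RatFunc.laurent (-a) (RatFunc.laurent a f) = f
      rw [RatFunc.laurent_laurent]; simp
    · show RatFunc.laurent a (RatFunc.laurent (-a) _) = _
      rw [RatFunc.laurent_laurent]; simp
    · rw [RatFunc.laurent_X]
      have : (RatFunc.X + RatFunc.C (-a) : RatFunc k) = algebraMap k[X] _ (X - C a) := by
        simp [sub_eq_add_neg]
      rw [this]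
      show (maxIdealAt a).valuation (RatFunc k) _ = _
      rw [HeightOneSpectrum.valuation_of_algebraMap]
      exact (maxIdealAt a).intValuation_singleton (X_sub_C_ne_zero a) rfl

theorem val_toClosed (x : RatPoint k) (f : RatFunc k) :
    val x.toClosed f = Valued.v (expansion x f) := by
  obtain ⟨τ, h1, h2, h3⟩ := inLocalParam_rightInverse x
  have : (val x.toClosed).comap (τ : RatFunc k →+* RatFunc k) =
      (Polynomial.idealX k).valuation (RatFunc k) := by
    apply val_eq_of_X
    · intro c hc
      have hτ : τ (algebraMap k _ c) = algebraMap k _ c := τ.commutes c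
      show val x.toClosed (τ (algebraMap k _ c)) = 1
      rw [hτ]
      exact stalk_trivialOn x.toClosed hc
    · intro c hc
      have := stalk_trivialOn (x := ((Polynomial.idealX k : HeightOneSpectrum k[X]) :
        ClosedPoint k)) hc
      exact this
    · exact h3
    · rw [← RatFunc.algebraMap_X, HeightOneSpectrum.valuation_of_algebraMap]
      exact (Polynomial.idealX k).intValuation_singleton X_ne_zero rfl
  have h := congrArg (fun v => v (inLocalParam x f)) this
  simp only [Valuation.comap_apply] at h
  rw [show ((τ : RatFunc k →+* RatFunc k) (inLocalParam x f)) = f from h1 f] at h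
  rw [h, expansion, RatFunc.valuation_eq_LaurentSeries_valuation]
  rfl

theorem val_le_iff (x : RatPoint k) (f : RatFunc k) (m : ℤ) :
    val x.toClosed f ≤ exp m ↔ ∀ j : ℤ, j < -m → (expansion x f).coeff j = 0 := by
  rw [val_toClosed, ← LaurentSeries.valuation_le_iff_coeff_lt_eq_zero, neg_neg]

/-- The map `O(G)_x → k` sending `f` to the value at `x` of `u ^ G(x) * f`, where `u` is the local
parameter `t - a` at `t = a`, and `1/t` at `∞`. -/
def stalkEval (G : Divisor k) (x : RatPoint k) : stalk G x.toClosed →ₗ[k] k where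
  toFun f := (expansion x f.1).coeff (-G x.toClosed)
  map_add' f g := by simp [expansion]
  map_smul' c f := by
    have : expansion x (c • f.1) = HahnSeries.C c * expansion x f.1 := by
      rw [expansion, expansion, Algebra.smul_def, map_mul, AlgHom.commutes, map_mul,
        RatFunc.algebraMap_eq_C, ← RatFunc.algebraMap_C]
      congr 1
      exact (RatFunc.coe_coe (C c)).symm.trans (by rw [Polynomial.coe_C, PowerSeries.coe_C])
    simp [this]

theorem ker_stalkEval (G : Divisor k) (x : RatPoint k) :
    LinearMap.ker (stalkEval G x) = maxStalk G x.toClosed := by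
  ext ⟨f, hf⟩
  have hf' : val x.toClosed f ≤ exp (G x.toClosed) := hf
  have h : (⟨f, hf⟩ : stalk G x.toClosed) ∈ maxStalk G x.toClosed ↔
      val x.toClosed f ≤ exp (G x.toClosed - 1) := by
    show val x.toClosed f ≤ exp ((G - Finsupp.single x.toClosed 1 : Divisor k) x.toClosed) ↔ _
    simp
  rw [h, LinearMap.mem_ker]
  show (expansion x f).coeff (-G x.toClosed) = 0 ↔ _
  rw [val_le_iff] at hf' ⊢
  constructor
  · intro h0 j hj
    rcases lt_or_eq_of_le (show j ≤ -G x.toClosed by omega) with h1 | h1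
    · exact hf' j h1
    · rw [h1, h0]
  · intro h0
    exact h0 _ (by omega)

theorem stalkEval_surjective (G : Divisor k) (x : RatPoint k) :
    Function.Surjective (stalkEval G x) := by
  obtain ⟨τ, h1, h2, h3⟩ := inLocalParam_rightInverse x
  have hexp : expansion x (τ RatFunc.X ^ (-G x.toClosed)) =
      HahnSeries.single (-G x.toClosed) (1 : k) := by
    rw [expansion, map_zpow₀, h2, map_zpow₀, RatFunc.coe_X, ← RatFunc.single_zpow]
  have hmem : τ RatFunc.X ^ (-G x.toClosed) ∈ stalk G x.toClosed := by
    show val x.toClosed _ ≤ _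
    rw [val_le_iff, hexp]
    intro j hj
    rw [HahnSeries.coeff_single_of_ne hj.ne]
  intro c
  refine ⟨c • ⟨_, hmem⟩, ?_⟩
  rw [map_smul]
  show c • (expansion x (τ RatFunc.X ^ (-G x.toClosed))).coeff (-G x.toClosed) = c
  rw [hexp, HahnSeries.coeff_single_same, smul_eq_mul, mul_one]

/-- The trivialization `O(G)|_x ≃ k` of the fibre at a rational point `x` given by
`f ↦ (u ^ G(x) * f)(x)`. For `G = d∞` it is `f ↦ f(a)` at `t = a`, and `f ↦ g(0)` with
`g(u) = u ^ d f(1/u)` at `∞`. -/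
def stdTriv (G : Divisor k) (x : RatPoint k) : Fiber G x.toClosed ≃ₗ[k] k :=
  (Submodule.quotEquivOfEq _ _ (ker_stalkEval G x).symm).trans
    ((stalkEval G x).quotKerEquivOfSurjective (stalkEval_surjective G x))

/-! ### Level structures and Goppa codes -/

variable (k) in
/-- A level structure of rank one, length `n` and degree `d` on the projective line: `n` distinct
rational points, an invertible sheaf `O(G)` of degree `d`, and trivializations of its fibres at
the points. -/
structure LevelStructure (n : ℕ) (d : ℤ) where
  point : Fin n → RatPoint k
  point_injective : Function.Injective point
  sheaf : Divisor k
  degree_sheaf : sheaf.degree = d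
  triv : ∀ i, Fiber sheaf (point i).toClosed ≃ₗ[k] k

namespace LevelStructure

variable {n : ℕ} {d : ℤ}

/-- The evaluation map `H⁰(P¹, O(G)) → ⨁ᵢ O(G)|_{pᵢ} ≃ kⁿ`. -/
def eval (g : LevelStructure k n d) : globalSections g.sheaf →ₗ[k] (Fin n → k) :=
  LinearMap.pi fun i => (g.triv i).toLinearMap ∘ₗ restrict g.sheaf (g.point i).toClosed

/-- The Goppa code of a level structure. -/
def code (g : LevelStructure k n d) : Submodule k (Fin n → k) := LinearMap.range g.eval

end LevelStructure

/-- The dual code, with respect to the standard pairing on `kⁿ`. -/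
def dualCode {n : ℕ} (c : Submodule k (Fin n → k)) : Submodule k (Fin n → k) where
  carrier := {w' | ∀ w ∈ c, w' ⬝ᵥ w = 0}
  zero_mem' w _ := zero_dotProduct w
  add_mem' {a b} ha hb w hw := by rw [add_dotProduct, ha w hw, hb w hw, add_zero]
  smul_mem' r a ha w hw := by rw [smul_dotProduct, ha w hw, smul_zero]

/-- A level structure is self-dual if its Goppa code is equal to the dual code. -/
def LevelStructure.IsSelfDual {n : ℕ} {d : ℤ} (g : LevelStructure k n d) : Prop :=
  g.code = dualCode g.code

/-- The level structure `(P¹, p₁, …, pₙ, O(d∞), l₁γ₁⁰, …, lₙγₙ⁰)`, where `γᵢ⁰` is the standard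
trivialization of `O(d∞)` at `pᵢ`. -/
def stdLevelStructure {n : ℕ} (d : ℤ) (p : Fin n → RatPoint k) (hp : Function.Injective p)
    (l : Fin n → kˣ) : LevelStructure k n d where
  point := p
  point_injective := hp
  sheaf := Finsupp.single OnePoint.infty d
  degree_sheaf := by simp [Divisor.degree, ClosedPoint.degree]
  triv i := (stdTriv _ (p i)).trans (LinearEquiv.smulOfUnit (l i))

/-! ### Meromorphic differentials -/

/-- The isomorphism `Ω_{k(t)/k} ≃ k(t)`, `f dt ↦ f`. -/
def diffEquiv : Ω[RatFunc k⁄k] ≃ₗ[RatFunc k] RatFunc k :=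
  haveI : Algebra.FormallyEtale k[X] (RatFunc k) :=
    Algebra.FormallyEtale.of_isLocalization (M := k[X]⁰)
  (tensorKaehlerEquivOfFormallyEtale k k[X] (RatFunc k)).symm.trans
    (((polynomialEquiv k).baseChange k[X] (RatFunc k) _ _).trans
      (TensorProduct.AlgebraTensorModule.rid k[X] (RatFunc k) (RatFunc k)))

theorem diffEquiv_D_X : diffEquiv (D k (RatFunc k) RatFunc.X) = 1 := by
  have : Algebra.FormallyEtale k[X] (RatFunc k) :=
    Algebra.FormallyEtale.of_isLocalization (M := k[X]⁰)
  rw [← RatFunc.algebraMap_X, diffEquiv]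
  simp only [LinearEquiv.trans_apply, tensorKaehlerEquivOfFormallyEtale_symm_D_algebraMap]
  simp [polynomialEquiv_D]

theorem diffEquiv_symm (f : RatFunc k) :
    diffEquiv.symm f = f • D k (RatFunc k) RatFunc.X := by
  rw [LinearEquiv.symm_apply_eq, map_smul, diffEquiv_D_X, smul_eq_mul, mul_one]

/-- A function whose differential generates the regular differentials at `x`: it is `t` at the
finite points and `1/t` at `∞`. At a rational point it has the same differential as the local
parameter `u`. -/
def coord (x : ClosedPoint k) : RatFunc k := x.elim RatFunc.X⁻¹ fun _ => RatFunc.X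

/-- The rational function `f` such that `η = f ds`, where `s = coord x`. -/
def localCoeff (x : ClosedPoint k) (η : Ω[RatFunc k⁄k]) : RatFunc k :=
  diffEquiv η / diffEquiv (D k (RatFunc k) (coord x))

theorem diffEquiv_D_coord_ne_zero (x : ClosedPoint k) :
    diffEquiv (D k (RatFunc k) (coord x)) ≠ 0 := by
  induction x using OnePoint.rec with
  | infty =>
    show diffEquiv (D k (RatFunc k) (RatFunc.X)⁻¹) ≠ 0
    rw [Derivation.leibniz_inv, map_smul, diffEquiv_D_X]
    simp [RatFunc.X_ne_zero]
  | coe v =>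
    show diffEquiv (D k (RatFunc k) RatFunc.X) ≠ 0
    rw [diffEquiv_D_X]
    exact one_ne_zero

theorem localCoeff_eq_iff (x : ClosedPoint k) (η : Ω[RatFunc k⁄k]) (f : RatFunc k) :
    localCoeff x η = f ↔ η = f • D k (RatFunc k) (coord x) := by
  rw [localCoeff, div_eq_iff (diffEquiv_D_coord_ne_zero x), ← smul_eq_mul, ← map_smul,
    diffEquiv.injective.eq_iff]

/-- The differential `η` has order at least `m` at `x`: either `η = 0` or `ord_x η ≥ m`. -/
def OrdGE (x : ClosedPoint k) (m : ℤ) (η : Ω[RatFunc k⁄k]) : Prop :=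
  val x (localCoeff x η) ≤ exp (-m)

/-- The residue at a rational point: the coefficient of `u⁻¹ du` in the expansion of `η`. -/
def residue (x : RatPoint k) (η : Ω[RatFunc k⁄k]) : k :=
  (expansion x (localCoeff x.toClosed η)).coeff (-1)

end GoppaP1

end

open GoppaP1

/-! Write `P = ∏ (t - αᵢ)` over the `2d + 1` finite points. Self-duality and the existence of `η`
both reduce to the same equations `lᵢ² P'(αᵢ) = -l₁²` for `i ≥ 2`.

Code side (`stdLevelStructure_isSelfDual_iff`): evaluation is injective on polynomials of degree at
most `d`, so the code has dimension `d + 1 = n / 2`, and self-duality amounts to self-orthogonality.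
Products of two such polynomials span the polynomials `h` of degree at most `2d`, so the condition
is that `l₁² h_{2d} + ∑ lᵢ² h(αᵢ)` vanishes for all of them. By Lagrange interpolation the leading
coefficient is `h_{2d} = ∑ h(αᵢ) / P'(αᵢ)`; since the values `h(αᵢ)` are arbitrary, this forces the
stated equations.

Differential side (`simple_poles_iff`, `ordGE_iff`): the order conditions on `η = f dt` make `f P` a
polynomial of degree at most `0`, so `η = c dt / P`. Its residue at `αᵢ` is `c / P'(αᵢ)`
(`residue_coe_mul`), and that of `η / u^{2d}` at `∞` is `-c` (`residue_infty`). The residue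
conditions thus say `c = -l₁²` and `lᵢ² P'(αᵢ) = c`. -/

open Lagrange

/-! ### Quadrature on polynomials -/

section Quadrature

variable {k ι : Type*} [Field k]

/-- A combination of point evaluations and the top coefficient kills all polynomials of degree at
most `m` exactly when its weights are proportional to those of Lagrange interpolation. -/
theorem quadrature_eq_zero_iff [DecidableEq ι] {s : Finset ι} {v : ι → k} (hv : Set.InjOn v s) {m : ℕ}
    (hs : s.card = m + 1) (c : k) (w : ι → k) :
    (∀ h : k[X], h.natDegree ≤ m → c * h.coeff m + ∑ i ∈ s, w i * h.eval (v i) = 0) ↔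
      ∀ i ∈ s, w i * (nodal (s.erase i) v).eval (v i) = -c := by
  constructor
  · intro H i hi
    have hcard : (s.erase i).card = m := by rw [Finset.card_erase_of_mem hi, hs]; rfl
    have hdeg : (nodal (s.erase i) v).natDegree = m := by rw [natDegree_nodal, hcard]
    have h1 : (nodal (s.erase i) v).coeff m = 1 := by
      have := (nodal_monic (s := s.erase i) (v := v)).coeff_natDegree
      rwa [hdeg] at this
    -- The test polynomial is monic of degree `m` and vanishes at every node except `v i`, so only
    -- two terms survive.
    have h := H _ hdeg.le
    rw [h1, Finset.sum_eq_single i] at h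
    · linear_combination h
    · intro j hj hji
      rw [eval_nodal_at_node (Finset.mem_erase.2 ⟨hji, hj⟩), mul_zero]
    · exact fun h => absurd hi h
  · intro H h hh
    have hdeg : h.degree < s.card := by
      rw [hs]
      exact (natDegree_le_iff_degree_le.1 hh).trans_lt (by exact_mod_cast Nat.lt_succ_self m)
    -- With `m + 1` nodes, interpolation writes the coefficient of degree `m` as a weighted sum of
    -- values, which cancels term by term.
    have key := coeff_eq_sum hv hdeg
    rw [hs, Nat.add_sub_cancel] at key
    rw [key, Finset.mul_sum, ← Finset.sum_add_distrib]
    refine Finset.sum_eq_zero fun i hi => ?_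
    have hne : (nodal (s.erase i) v).eval (v i) ≠ 0 := by
      refine eval_nodal_not_at_node fun j hj hij => ?_
      rw [Finset.mem_erase] at hj
      exact hj.1 (hv hj.2 hi hij.symm)
    have h1 := H i hi
    rw [← eval_nodal, eq_div_of_mul_eq hne h1]
    ring

/-- Both sides are linear in the product `f * g`, and every monomial of degree at most `2 * d` is a
product of two monomials of degree at most `d`. -/
theorem quadrature_mul_eq_zero_iff (s : Finset ι) (v : ι → k) (d : ℕ) (c : k) (w : ι → k) :
    (∀ f g : k[X], f.natDegree ≤ d → g.natDegree ≤ d →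
      c * (f.coeff d * g.coeff d) + ∑ i ∈ s, w i * (f.eval (v i) * g.eval (v i)) = 0) ↔
    ∀ h : k[X], h.natDegree ≤ 2 * d →
      c * h.coeff (2 * d) + ∑ i ∈ s, w i * h.eval (v i) = 0 := by
  constructor
  · intro H h hh
    let T : k[X] →ₗ[k] k := c • lcoeff k (2 * d) + ∑ i ∈ s, w i • Polynomial.leval (v i)
    have hT : ∀ q, T q = c * q.coeff (2 * d) + ∑ i ∈ s, w i * q.eval (v i) := by
      intro q; simp [T]
    rw [← hT, h.as_sum_range_C_mul_X_pow' (Nat.lt_succ_of_le hh), map_sum]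
    refine Finset.sum_eq_zero fun m hm => ?_
    rw [← smul_eq_C_mul, map_smul, smul_eq_zero]
    right
    have hm' : m ≤ 2 * d := Nat.lt_succ_iff.1 (Finset.mem_range.1 hm)
    obtain ⟨a, b, rfl, ha, hb⟩ : ∃ a b, m = a + b ∧ a ≤ d ∧ b ≤ d :=
      ⟨min m d, m - min m d, by omega, by omega, by omega⟩
    have h1 := H (X ^ a) (X ^ b) (by simpa using ha) (by simpa using hb)
    -- The top coefficient is multiplicative under these degree bounds, even when the actual degrees
    -- are smaller.
    rw [hT, pow_add, two_mul, coeff_mul_add_eq_of_natDegree_le (by simpa using ha) (by simpa using hb)]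
    simpa using h1
  · intro H f g hf hg
    have := H (f * g) (by rw [two_mul]; exact natDegree_mul_le_of_le hf hg)
    rw [two_mul, coeff_mul_add_eq_of_natDegree_le hf hg] at this
    simpa using this

end Quadrature

/-! ### Dual codes -/

namespace GoppaP1

theorem finrank_dualCode {k : Type*} [Field k] {n : ℕ} (c : Submodule k (Fin n → k)) :
    Module.finrank k (dualCode c) = n - Module.finrank k c := by
  have h : dualCode c = c.dualAnnihilator.comap (dotProductEquiv k (Fin n)).toLinearMap := by
    ext w
    rw [Submodule.mem_comap, Submodule.mem_dualAnnihilator]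
    rfl
  have h2 := (LinearEquiv.submoduleMap (dotProductEquiv k (Fin n)).symm
    c.dualAnnihilator).finrank_eq
  rw [h, Submodule.comap_equiv_eq_map_symm]
  have h1 := Subspace.finrank_add_finrank_dualAnnihilator_eq c
  rw [Module.finrank_fin_fun] at h1
  have h3 : Module.finrank k (Submodule.map (dotProductEquiv k (Fin n)).symm.toLinearMap
      c.dualAnnihilator) = Module.finrank k c.dualAnnihilator := h2.symm
  exact h3.trans (by omega)

/-- The standard pairing is nondegenerate, so the dual has complementary dimension; for a
half-dimensional code an inclusion is an equality. -/
theorem eq_dualCode_iff_le {k : Type*} [Field k] {n : ℕ} {c : Submodule k (Fin n → k)}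
    (hc : n = 2 * Module.finrank k c) : c = dualCode c ↔ c ≤ dualCode c := by
  refine ⟨fun h => h.le, fun h => Submodule.eq_of_le_of_finrank_eq h ?_⟩
  rw [finrank_dualCode]
  omega

/-! ### Expansions of polynomials -/

variable {k : Type*} [Field k]

theorem expansion_mul (x : RatPoint k) (f g : RatFunc k) :
    expansion x (f * g) = expansion x f * expansion x g := by
  simp only [expansion, map_mul]

theorem expansion_coe (a : k) (p : k[X]) :
    expansion (OnePoint.some a) (algebraMap k[X] (RatFunc k) p) = ((taylor a p : PowerSeries k) : k⸨X⸩) := by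
  have : inLocalParam (OnePoint.some a) (algebraMap k[X] (RatFunc k) p) =
    algebraMap k[X] (RatFunc k) (taylor a p) := RatFunc.laurent_algebraMap ..
  rw [expansion, this]
  exact (RatFunc.coe_coe _).symm

theorem coeff_expansion_coe (a : k) (p : k[X]) (j : ℕ) :
    (expansion (OnePoint.some a) (algebraMap k[X] (RatFunc k) p)).coeff j =
      (taylor a p).coeff j := by
  rw [expansion_coe, LaurentSeries.coeff_coe_powerSeries, Polynomial.coeff_coe]

theorem expansion_C (x : RatPoint k) (c : k) :
    expansion x (algebraMap k (RatFunc k) c) = HahnSeries.C c := by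
  rw [expansion, AlgHom.commutes, RatFunc.algebraMap_eq_C, ← RatFunc.algebraMap_C]
  exact (RatFunc.coe_coe (C c)).symm.trans (by rw [Polynomial.coe_C, PowerSeries.coe_C])

/-- The local parameter is `u = 1/t`, so `t ^ j` contributes at exponent `-j`. -/
theorem coeff_expansion_infty (p : k[X]) (j : ℕ) :
    (expansion OnePoint.infty (algebraMap k[X] (RatFunc k) p)).coeff (-j) = p.coeff j := by
  have hX : expansion OnePoint.infty (algebraMap k[X] (RatFunc k) X) =
      HahnSeries.single (-1) (1 : k) := by
    have : inLocalParam OnePoint.infty (RatFunc.X : RatFunc k) = RatFunc.X⁻¹ := substInv_X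
    rw [RatFunc.algebraMap_X, expansion, this, map_inv₀, RatFunc.coe_X, ← zpow_neg_one,
      ← RatFunc.single_zpow]
  induction p using Polynomial.induction_on' with
  | add p q hp hq =>
    rw [map_add, expansion, map_add, map_add, HahnSeries.coeff_add]
    exact (congrArg₂ (· + ·) hp hq).trans (coeff_add p q j).symm
  | monomial m a =>
    have h : expansion OnePoint.infty (algebraMap k[X] (RatFunc k) (X ^ m)) =
        HahnSeries.single (-(m : ℤ)) (1 : k) := by
      have h' : expansion OnePoint.infty (algebraMap k[X] (RatFunc k) (X ^ m)) =
        expansion OnePoint.infty (algebraMap k[X] (RatFunc k) X) ^ m := by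
        simp only [expansion, map_pow]
      rw [h', hX, HahnSeries.single_pow]
      simp
    rw [← C_mul_X_pow_eq_monomial, map_mul, expansion_mul, h, RatFunc.algebraMap_C,
      ← RatFunc.algebraMap_eq_C, expansion_C, HahnSeries.C_mul_eq_smul, HahnSeries.coeff_smul,
      coeff_C_mul, coeff_X_pow, HahnSeries.coeff_single]
    simp

/-- The leading coefficients of two expansions multiply. -/
theorem coeff_expansion_mul {x : RatPoint k} {f g : RatFunc k} {a b : ℤ}
    (hf : val x.toClosed f ≤ exp (-a)) (hg : val x.toClosed g ≤ exp (-b)) :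
    (expansion x (f * g)).coeff (a + b) = (expansion x f).coeff a * (expansion x g).coeff b := by
  rw [val_le_iff, neg_neg] at hf hg
  rw [expansion_mul, HahnSeries.coeff_mul]
  -- Exponents in the supports are at least `a` and `b`, so only the pair `(a, b)` can have sum `a +
  -- b`.
  refine Finset.sum_eq_single (a, b) (fun ij h hne => ?_) fun h => ?_
  · simp only [Finset.mem_antidiagonal, HahnSeries.mem_support] at h
    have h1 : a ≤ ij.1 := not_lt.1 fun h' => h.1 (hf _ h')
    have h2 : b ≤ ij.2 := not_lt.1 fun h' => h.2.1 (hg _ h')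
    exact absurd (Prod.ext (by omega) (by omega)) hne
  · simp only [Finset.mem_antidiagonal, HahnSeries.mem_support, and_true] at h
    by_contra h0
    exact h ⟨left_ne_zero_of_mul h0, right_ne_zero_of_mul h0⟩

end GoppaP1

namespace GoppaP1

variable {k : Type*} [Field k]

/-! ### Valuations of polynomials -/

theorem val_infty_coe {p : k[X]} (hp : p ≠ 0) :
    val OnePoint.infty (algebraMap k[X] (RatFunc k) p) = exp (p.natDegree : ℤ) := by
  classical
  rw [← RatFunc.inftyValuation.polynomial k hp]
  simp only [val, OnePoint.elim_infty]
  congr!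

theorem val_infty_coe_le_iff (p : k[X]) (m : ℕ) :
    val OnePoint.infty (algebraMap k[X] (RatFunc k) p) ≤ exp (m : ℤ) ↔ p.natDegree ≤ m := by
  by_cases hp : p = 0
  · simp [hp]
  · rw [val_infty_coe hp, exp_le_exp, Nat.cast_le]

theorem val_infty_X : val OnePoint.infty (RatFunc.X : RatFunc k) = exp 1 := by
  rw [← RatFunc.algebraMap_X, val_infty_coe X_ne_zero, natDegree_X, Nat.cast_one]

theorem val_coe_le_one (v : HeightOneSpectrum k[X]) (p : k[X]) :
    val (OnePoint.some v) (algebraMap k[X] (RatFunc k) p) ≤ 1 :=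
  v.valuation_le_one p

theorem exists_coe_eq_of_val_le_one {f : RatFunc k}
    (hf : ∀ v : HeightOneSpectrum k[X], val (OnePoint.some v) f ≤ 1) :
    ∃ p : k[X], algebraMap k[X] (RatFunc k) p = f :=
  HeightOneSpectrum.mem_integers_of_valuation_le_one (RatFunc k) f hf

theorem val_maxIdealAt_X_sub_C (a : k) :
    val (OnePoint.some (maxIdealAt a)) (algebraMap k[X] (RatFunc k) (X - C a)) = exp (-1) := by
  show (maxIdealAt a).valuation (RatFunc k) _ = _
  rw [HeightOneSpectrum.valuation_of_algebraMap]
  exact (maxIdealAt a).intValuation_singleton (X_sub_C_ne_zero a) rfl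

theorem val_X_sub_C_of_ne {v : HeightOneSpectrum k[X]} {a : k} (hv : v ≠ maxIdealAt a) :
    val (OnePoint.some v) (algebraMap k[X] (RatFunc k) (X - C a)) = 1 := by
  show v.valuation (RatFunc k) _ = _
  refine (v.valuation_eq_one_iff_notMem (K := RatFunc k)).2 fun h => hv ?_
  have hle : (maxIdealAt a).asIdeal ≤ v.asIdeal := (Ideal.span_singleton_le_iff_mem _).2 h
  exact HeightOneSpectrum.ext ((maxIdealAt a).isMaximal.eq_of_le v.isPrime.ne_top hle).symm

theorem maxIdealAt_injective : Function.Injective (maxIdealAt : k → HeightOneSpectrum k[X]) := by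
  intro a b h
  by_contra hab
  have h1 := val_maxIdealAt_X_sub_C a
  rw [h] at h1
  have h2 := val_X_sub_C_of_ne (v := maxIdealAt b) (a := a)
    fun h' => hab (by
      have h3 : (X - C b : k[X]) ∈ (maxIdealAt a).asIdeal := by
        rw [h]; exact Ideal.mem_span_singleton_self _
      have h4 : X - C a ∣ X - C b := Ideal.mem_span_singleton.1 h3
      have h5 := dvd_iff_isRoot.1 h4
      simpa [sub_eq_zero] using h5)
  rw [h1] at h2
  simp at h2

theorem val_nodal_of_forall_ne {ι : Type*} {s : Finset ι} {α : ι → k} {v : HeightOneSpectrum k[X]}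
    (hv : ∀ i ∈ s, v ≠ maxIdealAt (α i)) :
    val (OnePoint.some v) (algebraMap k[X] (RatFunc k) (Lagrange.nodal s α)) = 1 := by
  rw [Lagrange.nodal_eq, map_prod, map_prod]
  exact Finset.prod_eq_one fun i hi => val_X_sub_C_of_ne (hv i hi)

theorem val_nodal_node {ι : Type*} [DecidableEq ι] {s : Finset ι} {α : ι → k}
    (hα : Set.InjOn α s) {i : ι} (hi : i ∈ s) :
    val (OnePoint.some (maxIdealAt (α i)))
      (algebraMap k[X] (RatFunc k) (Lagrange.nodal s α)) = exp (-1) := by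
  rw [Lagrange.nodal_eq_mul_nodal_erase hi, map_mul, map_mul, val_maxIdealAt_X_sub_C,
    val_nodal_of_forall_ne, mul_one]
  intro j hj h
  rw [Finset.mem_erase] at hj
  exact hj.1 (hα hj.2 hi (maxIdealAt_injective h).symm)

/-- The rational functions with at most simple poles at the nodes, regular at the other finite
points, and vanishing at `∞` to an order at least the number of nodes. -/
theorem simple_poles_iff {ι : Type*} {s : Finset ι} {α : ι → k}
    (hα : Set.InjOn α s) (f : RatFunc k) :
    ((∀ v : HeightOneSpectrum k[X], (∀ i ∈ s, v ≠ maxIdealAt (α i)) →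
        val (OnePoint.some v) f ≤ 1) ∧
      (∀ i ∈ s, val (OnePoint.some (maxIdealAt (α i))) f ≤ exp 1) ∧
      val OnePoint.infty f ≤ exp (-(s.card : ℤ))) ↔
    ∃ c : k, f * algebraMap k[X] (RatFunc k) (Lagrange.nodal s α) =
      algebraMap k (RatFunc k) c := by
  classical
  have hP : val OnePoint.infty (algebraMap k[X] (RatFunc k) (Lagrange.nodal s α)) =
      exp (s.card : ℤ) := by
    rw [val_infty_coe Lagrange.nodal_ne_zero, Lagrange.natDegree_nodal]
  constructor
  · rintro ⟨h1, h2, h3⟩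
    -- Multiplying by the nodal polynomial clears all finite poles, leaving a polynomial; the
    -- vanishing order at `∞` then bounds its degree by `0`.
    obtain ⟨q, hq⟩ := exists_coe_eq_of_val_le_one
        (f := f * algebraMap k[X] (RatFunc k) (Lagrange.nodal s α)) fun v => by
      by_cases hv : ∀ i ∈ s, v ≠ maxIdealAt (α i)
      · rw [map_mul, val_nodal_of_forall_ne hv, mul_one]
        exact h1 v hv
      · push Not at hv
        obtain ⟨i, hi, rfl⟩ := hv
        rw [map_mul, val_nodal_node hα hi]
        exact (mul_le_mul' (h2 i hi) le_rfl).trans (by rw [← exp_add]; simp)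
    have hdeg : q.natDegree ≤ 0 := by
      rw [← val_infty_coe_le_iff, hq, map_mul, hP]
      exact (mul_le_mul' h3 le_rfl).trans (by rw [← exp_add]; simp)
    refine ⟨q.coeff 0, ?_⟩
    rw [← hq, eq_C_of_natDegree_le_zero hdeg, RatFunc.algebraMap_C, RatFunc.algebraMap_eq_C,
      coeff_C_zero]
  · rintro ⟨c, hc⟩
    have hle : ∀ x : ClosedPoint k, val x f * val x (algebraMap k[X] (RatFunc k)
        (Lagrange.nodal s α)) ≤ 1 := by
      intro x
      rw [← map_mul, hc]
      by_cases h0 : c = 0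
      · simp [h0]
      · exact (stalk_trivialOn x h0).le
    have key : ∀ (x : ClosedPoint k) (m : ℤ), val x (algebraMap k[X] (RatFunc k)
        (Lagrange.nodal s α)) = exp m → val x f ≤ exp (-m) := by
      intro x m hm
      have h := hle x
      rw [hm] at h
      calc val x f = val x f * exp m * exp (-m) := by rw [mul_assoc, ← exp_add]; simp
        _ ≤ 1 * exp (-m) := mul_le_mul' h le_rfl
        _ = exp (-m) := one_mul _
    refine ⟨fun v hv => ?_, fun i hi => ?_, key _ _ hP⟩
    · simpa using key (OnePoint.some v) 0 (by simpa using val_nodal_of_forall_ne hv)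
    · simpa using key _ _ (val_nodal_node hα hi)

/-! ### Global sections of `O(d∞)` and their evaluation -/

/-- Regularity at all finite places forces a polynomial, since `k[X]` is a Dedekind domain; the pole
bound at `∞` is the degree bound. -/
theorem mem_globalSections_iff (d : ℕ) (f : RatFunc k) :
    f ∈ globalSections (Finsupp.single OnePoint.infty (d : ℤ) : Divisor k) ↔
      ∃ p : k[X], p.natDegree ≤ d ∧ algebraMap k[X] (RatFunc k) p = f := by
  have hmem : f ∈ globalSections (Finsupp.single OnePoint.infty (d : ℤ) : Divisor k) ↔
      ∀ x, val x f ≤ exp ((Finsupp.single OnePoint.infty (d : ℤ) : Divisor k) x) :=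
    Submodule.mem_iInf _
  rw [hmem, OnePoint.forall]
  simp only [Finsupp.single_eq_same]
  have h0 : ∀ v : HeightOneSpectrum k[X],
      (Finsupp.single OnePoint.infty (d : ℤ) : Divisor k) (OnePoint.some v) = 0 :=
    fun v => Finsupp.single_eq_of_ne (OnePoint.coe_ne_infty v)
  simp only [h0, exp_zero]
  constructor
  · rintro ⟨h1, h2⟩
    obtain ⟨p, rfl⟩ := exists_coe_eq_of_val_le_one h2
    exact ⟨p, (val_infty_coe_le_iff p d).1 h1, rfl⟩
  · rintro ⟨p, hp, rfl⟩
    exact ⟨(val_infty_coe_le_iff p d).2 hp, fun v => val_coe_le_one v p⟩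

theorem stdLevelStructure_eval_apply {n : ℕ} (d : ℤ) (p : Fin n → RatPoint k)
    (hp : Function.Injective p) (l : Fin n → kˣ)
    (f : globalSections (stdLevelStructure d p hp l).sheaf) (i : Fin n) :
    (stdLevelStructure d p hp l).eval f i = l i * (expansion (p i) f.1).coeff
      (-(Finsupp.single OnePoint.infty d : Divisor k) (p i).toClosed) :=
  rfl

/-- The value of a polynomial, seen as a section of `O(d∞)`, in the standard trivialization. -/
noncomputable def stdValue (d : ℕ) (x : RatPoint k) : k[X] →ₗ[k] k :=
  x.elim (lcoeff k d) fun a => leval a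

theorem coeff_expansion_eq_stdValue (d : ℕ) (x : RatPoint k) (p : k[X]) :
    (expansion x (algebraMap k[X] (RatFunc k) p)).coeff
      (-(Finsupp.single OnePoint.infty (d : ℤ) : Divisor k) x.toClosed) = stdValue d x p := by
  induction x using OnePoint.rec with
  | infty =>
    have : (Finsupp.single OnePoint.infty (d : ℤ) : Divisor k)
        (RatPoint.toClosed (OnePoint.infty : RatPoint k)) = d := Finsupp.single_eq_same
    rw [this, coeff_expansion_infty]
    rfl
  | coe a =>
    have : (Finsupp.single OnePoint.infty (d : ℤ) : Divisor k)
        (RatPoint.toClosed (OnePoint.some a)) = 0 :=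
      Finsupp.single_eq_of_ne (OnePoint.coe_ne_infty _)
    rw [this, neg_zero]
    exact (coeff_expansion_coe a p 0).trans (taylor_coeff_zero a p)

/-- The encoding map of `stdLevelStructure d p hp l` on polynomials of degree at most `d`. -/
noncomputable def encode {n : ℕ} (d : ℕ) (p : Fin n → RatPoint k) (l : Fin n → kˣ) :
    degreeLT k (d + 1) →ₗ[k] (Fin n → k) :=
  LinearMap.pi fun i => (l i : k) • stdValue d (p i) ∘ₗ (degreeLT k (d + 1)).subtype

theorem mem_degreeLT_succ {d : ℕ} {f : k[X]} : f ∈ degreeLT k (d + 1) ↔ f.natDegree ≤ d := by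
  rw [mem_degreeLT, degree_lt_iff_coeff_zero, natDegree_le_iff_coeff_eq_zero]
  rfl

theorem stdLevelStructure_code {n : ℕ} (d : ℕ) (p : Fin n → RatPoint k)
    (hp : Function.Injective p) (l : Fin n → kˣ) :
    (stdLevelStructure (d : ℤ) p hp l).code = LinearMap.range (encode d p l) := by
  ext w
  constructor
  · rintro ⟨⟨f, hf⟩, rfl⟩
    obtain ⟨q, hq, rfl⟩ := (mem_globalSections_iff d f).1 hf
    refine ⟨⟨q, mem_degreeLT_succ.2 hq⟩, funext fun i => ?_⟩
    rw [stdLevelStructure_eval_apply, coeff_expansion_eq_stdValue]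
    rfl
  · rintro ⟨⟨q, hq⟩, rfl⟩
    refine ⟨⟨algebraMap k[X] (RatFunc k) q,
      (mem_globalSections_iff d _).2 ⟨q, mem_degreeLT_succ.1 hq, rfl⟩⟩, funext fun i => ?_⟩
    rw [stdLevelStructure_eval_apply, coeff_expansion_eq_stdValue]
    rfl

/-! ### Local coefficients and residues -/

theorem localCoeff_coe (v : HeightOneSpectrum k[X]) (η : Ω[RatFunc k⁄k]) :
    localCoeff (OnePoint.some v) η = diffEquiv η := by
  show diffEquiv η / diffEquiv (D k (RatFunc k) RatFunc.X) = _
  rw [diffEquiv_D_X, div_one]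

theorem localCoeff_infty (η : Ω[RatFunc k⁄k]) :
    localCoeff OnePoint.infty η = -(RatFunc.X ^ 2 * diffEquiv η) := by
  show diffEquiv η / diffEquiv (D k (RatFunc k) (RatFunc.X)⁻¹) = _
  rw [Derivation.leibniz_inv, map_smul, diffEquiv_D_X]
  have := RatFunc.X_ne_zero (K := k)
  simp only [smul_eq_mul]
  field_simp

theorem ordGE_coe_iff (v : HeightOneSpectrum k[X]) (m : ℤ) (η : Ω[RatFunc k⁄k]) :
    OrdGE (OnePoint.some v) m η ↔ val (OnePoint.some v) (diffEquiv η) ≤ exp (-m) := by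
  rw [OrdGE, localCoeff_coe]

/-- The shift by `2` is the double pole of `dt` at `∞`, from `dt = -t² du`. -/
theorem ordGE_infty_iff (m : ℤ) (η : Ω[RatFunc k⁄k]) :
    OrdGE OnePoint.infty m η ↔ val OnePoint.infty (diffEquiv η) ≤ exp (-(m + 2)) := by
  rw [OrdGE, localCoeff_infty, Valuation.map_neg, map_mul, map_pow, val_infty_X, ← exp_nsmul]
  have h : exp (-m) = exp (2 • 1) * exp (-(m + 2)) := by
    rw [← exp_add]; congr 1; simp
  rw [h, mul_le_mul_iff_right₀ (by simp)]

/-- At a node the coefficient of `dt` has at most a simple pole and the nodal polynomial a simple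
zero, so the constant term of their product is the residue times the derivative at the node. -/
theorem residue_coe_mul {ι : Type*} [DecidableEq ι] {s : Finset ι} {α : ι → k}
    (hα : Set.InjOn α s) {η : Ω[RatFunc k⁄k]} {c : k}
    (hη : diffEquiv η * algebraMap k[X] (RatFunc k) (Lagrange.nodal s α) =
      algebraMap k (RatFunc k) c) {i : ι} (hi : i ∈ s) :
    residue (OnePoint.some (α i)) η * (Lagrange.nodal (s.erase i) α).eval (α i) = c := by
  have hf := ((simple_poles_iff hα _).2 ⟨c, hη⟩).2.1 i hi
  have h := coeff_expansion_mul (x := OnePoint.some (α i)) (a := -1) (b := 1)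
    (by rw [neg_neg]; exact hf) (val_nodal_node hα hi).le
  rw [hη, expansion_C] at h
  have h1 : (expansion (OnePoint.some (α i))
      (algebraMap k[X] (RatFunc k) (Lagrange.nodal s α))).coeff 1 =
      (Lagrange.nodal (s.erase i) α).eval (α i) := by
    rw [← Lagrange.eval_nodal_derivative_eval_node_eq hi, ← taylor_coeff_one]
    exact coeff_expansion_coe _ _ 1
  have h2 : residue (OnePoint.some (α i)) η =
      (expansion (OnePoint.some (α i)) (diffEquiv η)).coeff (-1) := by
    rw [residue]
    exact congrArg (fun g => (expansion (OnePoint.some (α i)) g).coeff (-1)) (localCoeff_coe _ η)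
  rw [h2, ← h1, ← h]
  simp

/-- Dividing by `u ^ m` multiplies by `t ^ m`, and `dt = -t² du` gives the sign. The coefficient of
`du` times the monic nodal polynomial is `-c t ^ (m + 2)`, whose leading coefficient is the residue.
-/
theorem residue_infty {ι : Type*} {s : Finset ι} {α : ι → k}
    (hα : Set.InjOn α s) {η : Ω[RatFunc k⁄k]} {c : k}
    (hη : diffEquiv η * algebraMap k[X] (RatFunc k) (Lagrange.nodal s α) =
      algebraMap k (RatFunc k) c) {m : ℕ} (hm : s.card = m + 1) :
    residue OnePoint.infty (((RatFunc.X : RatFunc k)⁻¹ ^ m)⁻¹ • η) = -c := by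
  have hf := ((simple_poles_iff hα _).2 ⟨c, hη⟩).2.2
  set g := localCoeff OnePoint.infty (((RatFunc.X : RatFunc k)⁻¹ ^ m)⁻¹ • η) with hg
  have hg' : g = -(RatFunc.X ^ (m + 2) * diffEquiv η) := by
    rw [hg, localCoeff_infty, map_smul, smul_eq_mul, inv_pow, inv_inv]
    ring
  have hP : val OnePoint.infty (algebraMap k[X] (RatFunc k) (Lagrange.nodal s α)) =
      exp (s.card : ℤ) := by
    rw [val_infty_coe Lagrange.nodal_ne_zero, Lagrange.natDegree_nodal]
  have hvg : val OnePoint.infty g ≤ exp 1 := by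
    rw [hg', Valuation.map_neg, map_mul, map_pow, val_infty_X, ← exp_nsmul]
    refine (mul_le_mul' le_rfl hf).trans ?_
    rw [← exp_add, exp_le_exp, hm]
    simp
    omega
  have h := coeff_expansion_mul (x := OnePoint.infty) (a := -1) (b := -(s.card : ℤ))
    (f := g) (by rw [neg_neg]; exact hvg) (by rw [neg_neg]; exact hP.le)
  have hgP : g * algebraMap k[X] (RatFunc k) (Lagrange.nodal s α) =
      algebraMap k[X] (RatFunc k) (C (-c) * X ^ (m + 2)) := by
    rw [hg', map_mul, map_pow, RatFunc.algebraMap_X, RatFunc.algebraMap_C, map_neg,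
      ← RatFunc.algebraMap_eq_C, ← hη]
    ring
  have h1 : (Lagrange.nodal s α).coeff s.card = 1 := by
    have := (Lagrange.nodal_monic (s := s) (v := α)).coeff_natDegree
    rwa [Lagrange.natDegree_nodal] at this
  rw [hgP, coeff_expansion_infty, h1, mul_one,
    show (-1 + -(s.card : ℤ)) = -((m + 2 : ℕ) : ℤ) by rw [hm]; push_cast; ring,
    coeff_expansion_infty, coeff_C_mul, coeff_X_pow_self, mul_one] at h
  exact h.symm

end GoppaP1

namespace GoppaP1

variable {k : Type*} [Field k]

/-! ### Self-duality of the standard code as equations on the weights -/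

section StandardCode

variable {d n : ℕ} {p : Fin n → RatPoint k} {i₀ : Fin n} {α : Fin n → k}

theorem injOn_of_coe_eq {k : Type*} {p : Fin n → OnePoint k} {α : Fin n → k}
    (hp : Function.Injective p) (hα : ∀ i ≠ i₀, p i = OnePoint.some (α i)) :
    Set.InjOn α (Finset.univ.erase i₀) := by
  intro i hi j hj h
  refine hp ?_
  rw [hα i (Finset.ne_of_mem_erase hi), hα j (Finset.ne_of_mem_erase hj), h]

theorem finrank_range_encode (hn : n = 2 * (1 + d)) (hp : Function.Injective p)
    (hα : ∀ i ≠ i₀, p i = OnePoint.some (α i)) (l : Fin n → kˣ) :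
    Module.finrank k (LinearMap.range (encode d p l)) = d + 1 := by
  have hinj : Function.Injective (encode d p l) := by
    rw [← LinearMap.ker_eq_bot, LinearMap.ker_eq_bot']
    rintro ⟨f, hf⟩ h
    refine Subtype.ext ?_
    -- A polynomial in the kernel vanishes at all `n - 1 = 2d + 1` finite nodes, more than its
    -- degree allows.
    refine eq_zero_of_degree_lt_of_eval_index_eq_zero (s := Finset.univ.erase i₀)
      (v := α) (injOn_of_coe_eq hp hα) ?_ fun i hi => ?_
    · refine (mem_degreeLT.1 hf).trans_le ?_
      rw [Finset.card_erase_of_mem (Finset.mem_univ _), Finset.card_univ, Fintype.card_fin]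
      exact_mod_cast (by omega : d + 1 ≤ n - 1)
    · have h1 : (l i : k) * stdValue d (p i) f = 0 := congrFun h i
      rw [hα i (Finset.ne_of_mem_erase hi)] at h1
      exact (mul_eq_zero.1 h1).resolve_left (l i).ne_zero
  rw [LinearMap.finrank_range_of_inj hinj, (degreeLTEquiv k (d + 1)).finrank_eq,
    Module.finrank_fin_fun]

theorem encode_dotProduct (h₀ : p i₀ = OnePoint.infty)
    (hα : ∀ i ≠ i₀, p i = OnePoint.some (α i)) (l : Fin n → kˣ)
    (f g : degreeLT k (d + 1)) :
    encode d p l f ⬝ᵥ encode d p l g = (l i₀ : k) ^ 2 * (f.1.coeff d * g.1.coeff d) +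
      ∑ i ∈ Finset.univ.erase i₀, (l i : k) ^ 2 * (f.1.eval (α i) * g.1.eval (α i)) := by
  have h : ∀ (f : degreeLT k (d + 1)) i, encode d p l f i = l i * stdValue d (p i) f.1 :=
    fun _ _ => rfl
  rw [dotProduct, ← Finset.add_sum_erase _ _ (Finset.mem_univ i₀)]
  congr 1
  · rw [h, h, h₀]
    show (l i₀ * f.1.coeff d) * (l i₀ * g.1.coeff d) = _
    ring
  · refine Finset.sum_congr rfl fun i hi => ?_
    rw [h, h, hα i (Finset.ne_of_mem_erase hi)]
    show (l i * f.1.eval (α i)) * (l i * g.1.eval (α i)) = _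
    ring

theorem stdLevelStructure_isSelfDual_iff (hn : n = 2 * (1 + d)) (hp : Function.Injective p)
    (h₀ : p i₀ = OnePoint.infty) (hα : ∀ i ≠ i₀, p i = OnePoint.some (α i)) (l : Fin n → kˣ) :
    (stdLevelStructure (d : ℤ) p hp l).IsSelfDual ↔ ∀ i ∈ Finset.univ.erase i₀,
      (l i : k) ^ 2 * (Lagrange.nodal ((Finset.univ.erase i₀).erase i) α).eval (α i) =
        -(l i₀ : k) ^ 2 := by
  have hs : (Finset.univ.erase i₀ : Finset (Fin n)).card = 2 * d + 1 := by
    rw [Finset.card_erase_of_mem (Finset.mem_univ _), Finset.card_univ, Fintype.card_fin]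
    omega
  rw [← quadrature_eq_zero_iff (injOn_of_coe_eq hp hα) hs, ← quadrature_mul_eq_zero_iff,
    LevelStructure.IsSelfDual, stdLevelStructure_code, eq_dualCode_iff_le
      (by rw [finrank_range_encode hn hp hα]; omega)]
  constructor
  · intro H f g hf hg
    rw [← mem_degreeLT_succ] at hf hg
    have h := H (LinearMap.mem_range_self (encode d p l) ⟨f, hf⟩) _
      (LinearMap.mem_range_self (encode d p l) ⟨g, hg⟩)
    rwa [encode_dotProduct h₀ hα] at h
  · rintro H _ ⟨f, rfl⟩ _ ⟨g, rfl⟩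
    rw [encode_dotProduct h₀ hα]
    exact H f.1 g.1 (mem_degreeLT_succ.1 f.2) (mem_degreeLT_succ.1 g.2)

end StandardCode

/-! ### Differentials with prescribed orders and the final comparison -/

/-- The order conditions on a differential with at most simple poles at the nodes. -/
theorem ordGE_iff {ι : Type*} {s : Finset ι} {α : ι → k} (hα : Set.InjOn α s) {m : ℤ}
    (hm : (s.card : ℤ) = m + 2) (η : Ω[RatFunc k⁄k]) :
    ((∀ v : HeightOneSpectrum k[X], (∀ i ∈ s, v ≠ maxIdealAt (α i)) →
        OrdGE (OnePoint.some v) 0 η) ∧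
      (∀ i ∈ s, OrdGE (OnePoint.some (maxIdealAt (α i))) (-1) η) ∧ OrdGE OnePoint.infty m η) ↔
    ∃ c : k, diffEquiv η * algebraMap k[X] (RatFunc k) (Lagrange.nodal s α) =
      algebraMap k (RatFunc k) c := by
  simp only [← simple_poles_iff hα, ordGE_coe_iff, ordGE_infty_iff, hm, neg_neg, neg_zero,
    exp_zero]

end GoppaP1

theorem mainTheorem10 {k : Type*} [Field k] (d n : ℕ) (hd : 0 < d) (hn : n = 2 * (1 + d))
    (p : Fin n → RatPoint k) (hp : Function.Injective p)
    (hp₁ : p ⟨0, by omega⟩ = OnePoint.infty)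
    (hp₂ : p ⟨1, by omega⟩ = OnePoint.some (0 : k))
    (hp₃ : p ⟨2, by omega⟩ = OnePoint.some (1 : k))
    (l : Fin n → kˣ) (hl : l ⟨n - 1, by omega⟩ = 1) :
    (stdLevelStructure (d : ℤ) p hp l).IsSelfDual ↔
      ∃ η : Ω[RatFunc k⁄k],
        (∀ x : ClosedPoint k, (∀ i, x ≠ (p i).toClosed) → OrdGE x 0 η) ∧
        (∀ i : Fin n, 1 ≤ i.val → OrdGE (p i).toClosed (-1) η) ∧
        OrdGE (p ⟨0, by omega⟩).toClosed (2 * (d : ℤ) - 1) η ∧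
        (∀ i : Fin n, 1 ≤ i.val → residue (p i) η = (l i : k) ^ 2) ∧
        residue (p ⟨0, by omega⟩) (((RatFunc.X : RatFunc k)⁻¹ ^ (2 * d))⁻¹ • η) =
          (l ⟨0, by omega⟩ : k) ^ 2 := by
  set i₀ : Fin n := ⟨0, by omega⟩ with hi₀
  set s : Finset (Fin n) := Finset.univ.erase i₀ with hs
  have hmem : ∀ i : Fin n, i ∈ s ↔ 1 ≤ i.val := fun i => by
    simp only [hs, hi₀, Finset.mem_erase, Finset.mem_univ, and_true, ne_eq, Fin.ext_iff]
    omega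
  -- The coordinate chosen at `i₀`, the point at infinity, is a dummy value: the nodes are indexed
  -- by `s`, which omits `i₀`.
  have hex : ∀ i, ∃ a : k, i ≠ i₀ → p i = OnePoint.some a := fun i => by
    by_cases h : i = i₀
    · exact ⟨0, fun h' => absurd h h'⟩
    · obtain ⟨a, ha⟩ := OnePoint.ne_infty_iff_exists.1 fun h' => h (hp (h'.trans hp₁.symm))
      exact ⟨a, fun _ => ha.symm⟩
  choose α hα using hex
  have hαs : Set.InjOn α s := injOn_of_coe_eq hp hα
  have hcard : s.card = 2 * d + 1 := by
    rw [hs, Finset.card_erase_of_mem (Finset.mem_univ _), Finset.card_univ, Fintype.card_fin]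
    omega
  have hclosed : ∀ i ∈ s, (p i).toClosed = OnePoint.some (maxIdealAt (α i)) := fun i hi => by
    rw [hα i (Finset.ne_of_mem_erase hi)]; rfl
  have hclosed₀ : (p i₀).toClosed = OnePoint.infty := by rw [hp₁]; rfl
  have hord := fun η : Ω[RatFunc k⁄k] =>
    ordGE_iff hαs (m := 2 * (d : ℤ) - 1) (by rw [hcard]; push_cast; ring) η
  rw [stdLevelStructure_isSelfDual_iff hn hp hp₁ hα, ← hs]
  constructor
  · intro H
    set P := algebraMap k[X] (RatFunc k) (Lagrange.nodal s α) with hP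
    have hP0 : P ≠ 0 := (map_ne_zero_iff _ (RatFunc.algebraMap_injective k)).2
      Lagrange.nodal_ne_zero
    -- The constant `-l₁²` compensates the sign of the residue at `∞`.
    set η : Ω[RatFunc k⁄k] :=
      diffEquiv.symm (algebraMap k (RatFunc k) (-(l i₀ : k) ^ 2) / P) with hη
    have hc : diffEquiv η * P = algebraMap k (RatFunc k) (-(l i₀ : k) ^ 2) := by
      rw [hη, LinearEquiv.apply_symm_apply, div_mul_cancel₀ _ hP0]
    obtain ⟨h1, h2, h3⟩ := (hord η).2 ⟨_, hc⟩
    refine ⟨η, fun x hx => ?_, fun i hi => ?_, ?_, fun i hi => ?_, ?_⟩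
    · induction x using OnePoint.rec with
      | infty => exact absurd hclosed₀.symm (hx i₀)
      | coe v => exact h1 v fun i hi h => hx i (by rw [hclosed i hi, h])
    · rw [← hmem] at hi
      rw [hclosed i hi]
      exact h2 i hi
    · exact hclosed₀ ▸ h3
    · rw [← hmem] at hi
      rw [hα i (Finset.ne_of_mem_erase hi)]
      have h := residue_coe_mul hαs hc hi
      rw [← H i hi] at h
      -- The derivative factor can be cancelled: if it were zero, `H` would give `l₁ = 0`,
      -- contradicting that `l₁` is a unit.
      refine mul_right_cancel₀ (fun h0 => ?_) h
      have := H i hi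
      rw [h0, mul_zero] at this
      exact pow_ne_zero 2 (l i₀).ne_zero (neg_eq_zero.1 this.symm)
    · rw [hp₁, residue_infty hαs hc hcard, neg_neg]
  · rintro ⟨η, h1, h2, h3, h4, h5⟩
    have hc : ∃ c : k, diffEquiv η * algebraMap k[X] (RatFunc k) (Lagrange.nodal s α) =
        algebraMap k (RatFunc k) c := by
      refine (hord η).1 ⟨fun v hv => h1 _ fun i => ?_, fun i hi => ?_, hclosed₀ ▸ h3⟩
      · by_cases hi : i = i₀
        · rw [hi, hclosed₀]
          exact OnePoint.coe_ne_infty v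
        · have his : i ∈ s := Finset.mem_erase.2 ⟨hi, Finset.mem_univ i⟩
          rw [hclosed i his]
          exact fun h => hv i his (OnePoint.coe_injective h)
      · rw [← hclosed i hi]
        exact h2 i ((hmem i).1 hi)
    obtain ⟨c, hc⟩ := hc
    -- The condition at `∞` now reads `-c = l₁²`, which fixes the only free constant.
    rw [hp₁, residue_infty hαs hc hcard] at h5
    intro i hi
    rw [← h5, neg_neg, ← h4 i ((hmem i).1 hi), hα i (Finset.ne_of_mem_erase hi)]
    exact residue_coe_mul hαs hc hi
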